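/- Let $l\ge 0$ and $N_1,\ldots,N_l\ge 1$ be integers, and set $N=N_1+\cdots+N_l$. Let $\Gamma$ be one of the two groups $\mathbb Z_{N_1}\times\cdots\times\mathbb Z_{N_l}$ and $\mathbb Z_{N_1}*\cdots*\mathbb Z_{N_l}$, and let $C^*(\Gamma)$ be its full group $C^*$-algebra. Decompose $\{1,\ldots,N\}=A_1\sqcup\cdots\sqcup A_l$ with $|A_r|=N_r$, and label the elements of $A_r$ by the residues modulo $N_r$. The dual $\widehat\Gamma$ is regarded as a quantum permutation group, $\widehat\Gamma\subset S_N^+$, via the block diagonal magic unitary $u=(u_{ij})\in M_N(C^*(\Gamma))$ given by $u_{ij}=0$ if $i,j$ belong to different sets $A_r$, and by $$u_{ij}=\frac{1}{N_r}\sum_{k\in\mathbb Z_{N_r}}e^{2\pi\mathrm{i}(i-j)k/N_r}\,g^{(r)}_k\qquad\text{for } i,j\in A_r,$$ where $g^{(r)}_k\in\Gamma\subset C^*(\Gamma)$ is the image of $k$ under the canonical embedding $\mathbb Z_{N_r}\to\Gamma$. For $k\in\mathbb N$, write $(i_1,\ldots,i_k)\sim_k(j_1,\ldots,j_k)$ when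 $u_{i_1j_1}\cdots u_{i_kj_k}\ne 0$ in $C^*(\Gamma)$. (1) For both groups, and for every $k$, the relation $\sim_k$ on $\{1,\ldots,N\}^k$ is transitive, and is in fact an equivalence relation. Its classes are called the (algebraic) $k$-orbitals of $\widehat\Gamma$. (2) If at least two of the numbers $N_1,\ldots,N_l$ are $\ge 2$, the quantum groups $\widehat{\mathbb Z_{N_1}\times\cdots\times\mathbb Z_{N_l}}$ and $\widehat{\mathbb Z_{N_1}*\cdots*\mathbb Z_{N_l}}$ are distinguished by their $3$-orbitals: the two collections of $3$-orbitals are different, and the second quantum group has strictly fewer $3$-orbitals than the first one. -/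

import Mathlib

open scoped ENNReal

universe u v w

noncomputable section

/-- The C⋆-subalgebra generated by `S`: the closure of the ⋆-subalgebra generated by `S`. -/
def cstarSpan {A : Type w} [CStarAlgebra A] (S : Set A) : StarSubalgebra ℂ A :=
  (StarAlgebra.adjoin ℂ S).topologicalClosure

/-- The set `S` generates the C⋆-algebra `A`. -/
def GeneratesCStar {A : Type w} [CStarAlgebra A] (S : Set A) : Prop :=
  cstarSpan S = ⊤

theorem GeneratesCStar.of_subset {A : Type w} [CStarAlgebra A] {S T : Set A}
    (hT : GeneratesCStar T) (h : T ⊆ StarAlgebra.adjoin ℂ S) : GeneratesCStar S :=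
  eq_top_iff.2 (hT.ge.trans
    (StarSubalgebra.topologicalClosure_mono (StarAlgebra.adjoin_le h)))

theorem GeneratesCStar.of_incl {A : Type v} {B : Type w} [CStarAlgebra A] [CStarAlgebra B]
    (f : A →⋆ₐ[ℂ] B) (hf : Topology.IsInducing f) (S : Set A)
    (h : ∀ x, f x ∈ cstarSpan (f '' S)) : GeneratesCStar S := by
  refine eq_top_iff.2 fun x _ => ?_
  have hx := h x
  rw [cstarSpan, ← StarAlgHom.map_adjoin] at hx
  change x ∈ closure _
  rw [hf.closure_eq_preimage_closure_image]
  exact hx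

/-! ### The full group C⋆-algebra of a discrete group -/

/-- A unitary representation of the discrete group `Γ` on a nonzero complex Hilbert space.
(Every cyclic representation of `Γ` lives, up to unitary equivalence, in the universe of `Γ`.) -/
structure UnitaryRep (Γ : Type u) [Group Γ] : Type (u + 1) where
  /-- the Hilbert space -/
  H : Type u
  [normed : NormedAddCommGroup H]
  [inner : InnerProductSpace ℂ H]
  [complete : CompleteSpace H]
  [nontrivial : Nontrivial H]
  /-- the action by unitary operators -/
  toHom : Γ →* unitary (H →L[ℂ] H)

attribute [instance] UnitaryRep.normed UnitaryRep.inner UnitaryRep.complete UnitaryRep.nontrivial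

namespace GroupCStar

variable (Γ : Type u) [Group Γ]

/-- The algebra `B(H_ρ)` of bounded operators on the space of the representation `ρ`. -/
abbrev Op (ρ : UnitaryRep Γ) : Type u := ρ.H →L[ℂ] ρ.H

/-- The C⋆-algebra `∏_ρ B(H_ρ)` of bounded families of operators, indexed by all the unitary
representations of `Γ`, with the supremum norm. -/
def Ambient : Type (u + 1) := lp (Op Γ) ∞

/-- The C⋆-algebra structure of `∏_ρ B(H_ρ)`, with componentwise operations. -/
def ambientCStarAlgebra : CStarAlgebra (lp (Op Γ) ∞) where

instance : CStarAlgebra (Ambient Γ) := ambientCStarAlgebra Γ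

variable {Γ}

/-- The universal unitary representation: it sends `g` to the family `(ρ(g))_ρ`. -/
def univ : Γ →* Ambient Γ where
  toFun g := ⟨fun ρ => (ρ.toHom g : Op Γ ρ), memℓp_infty ⟨1, by
    rintro _ ⟨ρ, rfl⟩
    exact (CStarRing.norm_of_mem_unitary (ρ.toHom g).2).le⟩⟩
  map_one' := by
    refine Subtype.ext (funext fun ρ => ?_)
    change (ρ.toHom 1 : Op Γ ρ) = 1
    simp
  map_mul' g h := by
    refine Subtype.ext (funext fun ρ => ?_)
    change (ρ.toHom (g * h) : Op Γ ρ) = ρ.toHom g * ρ.toHom h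
    simp

theorem star_univ (g : Γ) : star (univ g) = univ g⁻¹ := by
  refine Subtype.ext (funext fun ρ => ?_)
  change star (ρ.toHom g : Op Γ ρ) = (ρ.toHom g⁻¹ : Op Γ ρ)
  rw [map_inv]
  rfl

variable (Γ)

/-- The closed ⋆-subalgebra generated by the universal unitary representation. -/
def closedSpan : StarSubalgebra ℂ (Ambient Γ) :=
  cstarSpan (Set.range (univ : Γ → Ambient Γ))

end GroupCStar

/-- The full group C⋆-algebra `C⋆(Γ)`: the completion of the group algebra `ℂ[Γ]` for the norm
`‖a‖ = sup_ρ ‖ρ(a)‖`, over all unitary representations `ρ`, realized as the closed linear span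
of the universal representation. -/
def GroupCStar (Γ : Type u) [Group Γ] : Type (u + 1) := GroupCStar.closedSpan Γ

namespace GroupCStar

variable {Γ : Type u} [Group Γ]

/-- The C⋆-algebra structure of `C⋆(Γ)`, inherited from `∏_ρ B(H_ρ)`. -/
def cstarAlgebra (Γ : Type u) [Group Γ] : CStarAlgebra (GroupCStar Γ) :=
  StarSubalgebra.cstarAlgebra (closedSpan Γ)
    (h_closed := StarSubalgebra.isClosed_topologicalClosure _)

instance : CStarAlgebra (GroupCStar Γ) := cstarAlgebra Γ

/-- The inclusion of `C⋆(Γ)` into the product of the algebras `B(H_ρ)`. -/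
def incl : GroupCStar Γ →⋆ₐ[ℂ] Ambient Γ := (closedSpan Γ).subtype

theorem incl_injective : Function.Injective (incl : GroupCStar Γ → Ambient Γ) :=
  Subtype.val_injective

theorem incl_isInducing : Topology.IsInducing (incl : GroupCStar Γ → Ambient Γ) :=
  Topology.IsInducing.subtypeVal

/-- The group elements, as elements of `C⋆(Γ)`. -/
def of : Γ →* GroupCStar Γ where
  toFun g := ⟨univ g, StarSubalgebra.le_topologicalClosure _
    (StarAlgebra.subset_adjoin ℂ _ ⟨g, rfl⟩)⟩
  map_one' := Subtype.ext (map_one univ)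
  map_mul' g h := Subtype.ext (map_mul univ g h)

theorem incl_of (g : Γ) : incl (of g) = univ g := rfl

theorem star_of (g : Γ) : star (of g : GroupCStar Γ) = of g⁻¹ :=
  incl_injective (by rw [map_star, incl_of, incl_of, star_univ])

theorem incl_mem (x : GroupCStar Γ) : incl x ∈ closedSpan Γ := x.2

theorem generates_of : GeneratesCStar (Set.range (of : Γ → GroupCStar Γ)) := by
  refine GeneratesCStar.of_incl incl incl_isInducing _ fun x => ?_
  have h : incl '' Set.range (of : Γ → GroupCStar Γ) = Set.range (univ : Γ → Ambient Γ) := by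
    rw [← Set.range_comp]
    exact congrArg Set.range (funext incl_of)
  rw [h]
  exact incl_mem x

end GroupCStar

/-! ### Magic unitaries and the relations `∼_k` -/

/-- A magic unitary over the C⋆-algebra `A`, with rows and columns labelled by the finite set `X`:
a square matrix of projections, summing up to `1` on each row and each column, whose entries
generate `A`. A closed subgroup of the quantum permutation group of `X` is given by
`A = C(G)` together with such a matrix. -/
structure MagicUnitary (X : Type v) [Fintype X] (A : Type w) [CStarAlgebra A] where
  /-- the matrix of coordinates -/
  mat : Matrix X X A
  isStarProjection : ∀ i j, IsStarProjection (mat i j)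
  row_sum : ∀ i, ∑ j, mat i j = 1
  col_sum : ∀ j, ∑ i, mat i j = 1
  generates : GeneratesCStar (Set.range fun p : X × X => mat p.1 p.2)

namespace MagicUnitary

variable {X : Type v} [Fintype X] {A : Type w} [CStarAlgebra A] (U : MagicUnitary X A)

/-- The relation `(i₁,…,i_k) ∼_k (j₁,…,j_k)`: the ordered product `u_{i₁j₁} ⋯ u_{i_kj_k}` is
nonzero. -/
def Rel (k : ℕ) (i j : Fin k → X) : Prop :=
  (List.ofFn fun a => U.mat (i a) (j a)).prod ≠ 0

/-- The classes of the relation `∼_k`; when `∼_k` is an equivalence relation, these are the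
(algebraic) `k`-orbitals. -/
def orbitals (k : ℕ) : Set (Set (Fin k → X)) :=
  Set.range fun i => {j | U.Rel k i j}

end MagicUnitary

/-! ### The cyclic groups -/

section Cyclic

variable {n : ℕ} [NeZero n] {A : Type w} [CStarAlgebra A]

/-- The matrix `u_{ij} = (1/n) ∑_k w^{(i-j)k} g_k`, where `w = exp(2πi/n)` and where `g_k ∈ A` is
the image of `k ∈ ℤ_n`. Here `ZMod.stdAddChar` is the character `a ↦ w^a` of `ℤ_n`. -/
def cyclicMatrix (g : Multiplicative (ZMod n) →* A) : Matrix (ZMod n) (ZMod n) A :=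
  fun i j => (n : ℂ)⁻¹ • ∑ k : ZMod n,
    (ZMod.stdAddChar ((i - j) * k) : ℂ) • g (Multiplicative.ofAdd k)

variable (g : Multiplicative (ZMod n) →* A)

theorem cyclicMatrix_eq (i j : ZMod n) : cyclicMatrix g i j = cyclicMatrix g (i - j) 0 := by
  simp [cyclicMatrix]

theorem cyclicMatrix_star (hg : ∀ x, star (g x) = g x⁻¹) (i j : ZMod n) :
    star (cyclicMatrix g i j) = cyclicMatrix g i j := by
  simp only [cyclicMatrix, star_smul, star_sum, hg]
  congr 1
  · simp
  · refine Fintype.sum_equiv (Equiv.neg _) _ _ fun k => ?_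
    simp only [Equiv.neg_apply, mul_neg, ofAdd_neg]
    congr 1
    rw [AddChar.map_neg_eq_conj]
    rfl

theorem cyclicMatrix_mul_self (i j : ZMod n) :
    cyclicMatrix g i j * cyclicMatrix g i j = cyclicMatrix g i j := by
  have hN : (n : ℂ) ≠ 0 := Nat.cast_ne_zero.2 (NeZero.ne _)
  have key : ∀ m : ZMod n,
      (ZMod.stdAddChar ((i - j) * m) : ℂ) • g (Multiplicative.ofAdd m) *
      ∑ k : ZMod n, (ZMod.stdAddChar ((i - j) * k) : ℂ) • g (Multiplicative.ofAdd k) =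
      ∑ k : ZMod n, (ZMod.stdAddChar ((i - j) * k) : ℂ) • g (Multiplicative.ofAdd k) := by
    intro m
    rw [Finset.mul_sum]
    refine Fintype.sum_equiv (Equiv.addLeft m) _ _ fun k => ?_
    rw [Equiv.coe_addLeft, ofAdd_add, map_mul g, mul_add, AddChar.map_add_eq_mul,
      smul_mul_smul_comm]
  simp only [cyclicMatrix, smul_mul_smul_comm]
  rw [Finset.sum_mul, Finset.sum_congr rfl fun m _ => key m, Finset.sum_const, Finset.card_univ,
    ZMod.card, ← Nat.cast_smul_eq_nsmul ℂ, smul_smul]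
  congr 1
  field_simp

/-- Fourier inversion. -/
theorem sum_cyclicMatrix (k : ZMod n) :
    ∑ a : ZMod n, (ZMod.stdAddChar (a * -k) : ℂ) • cyclicMatrix g a 0 =
      g (Multiplicative.ofAdd k) := by
  have hN : (n : ℂ) ≠ 0 := Nat.cast_ne_zero.2 (NeZero.ne _)
  have h1 : ∀ a : ZMod n, (ZMod.stdAddChar (a * -k) : ℂ) • cyclicMatrix g a 0 =
      ∑ m : ZMod n, ((n : ℂ)⁻¹ * ZMod.stdAddChar (a * (m - k))) •
        g (Multiplicative.ofAdd m) := by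
    intro a
    simp only [cyclicMatrix, sub_zero, Finset.smul_sum, smul_smul]
    refine Finset.sum_congr rfl fun m _ => ?_
    congr 1
    rw [sub_eq_add_neg, mul_add, AddChar.map_add_eq_mul]
    ring
  rw [Finset.sum_congr rfl fun a _ => h1 a, Finset.sum_comm]
  simp only [← Finset.sum_smul, ← Finset.mul_sum,
    AddChar.sum_mulShift _ (ZMod.isPrimitive_stdAddChar n), ZMod.card]
  rw [Finset.sum_eq_single k]
  · simp [hN]
  · intro m _ hm
    simp [sub_ne_zero.2 hm]
  · simp

theorem sum_cyclicMatrix_zero : ∑ a : ZMod n, cyclicMatrix g a 0 = 1 := by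
  simpa using sum_cyclicMatrix g 0

end Cyclic

/-! ### The group duals -/

namespace GroupDual

variable {l : ℕ} (N : Fin l → ℕ)

/-- The free product `ℤ_{N₁} * ⋯ * ℤ_{N_l}`. -/
abbrev FreeProd : Type := Monoid.CoprodI fun r => Multiplicative (ZMod (N r))

/-- The direct product `ℤ_{N₁} × ⋯ × ℤ_{N_l}`. -/
abbrev DirectProd : Type := ∀ r, Multiplicative (ZMod (N r))

/-- The canonical quotient map `ℤ_{N₁} * ⋯ * ℤ_{N_l} → ℤ_{N₁} × ⋯ × ℤ_{N_l}`. -/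
def freeToDirect : FreeProd N →* DirectProd N :=
  Monoid.CoprodI.lift fun r => MonoidHom.mulSingle (fun r => Multiplicative (ZMod (N r))) r

theorem freeToDirect_surjective : Function.Surjective (freeToDirect N) := by
  intro x
  have h : x ∈ (freeToDirect N).range := by
    refine Subgroup.pi_mem_of_mulSingle_mem x fun r => ?_
    exact ⟨Monoid.CoprodI.of (x r), by simp [freeToDirect]⟩
  exact h

/-- The set of `N₁ + ⋯ + N_l` points, as the disjoint union of the blocks `A_r`, with `A_r`
labelled by the residues modulo `N_r`. -/
abbrev Pts : Type := Σ r, ZMod (N r)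

variable {N} {Γ : Type u} [Group Γ]

/-- The group morphism `ℤ_{N_r} → Γ ⊂ C⋆(Γ)` associated to a quotient
`π : ℤ_{N₁} * ⋯ * ℤ_{N_l} → Γ`. -/
def gen (π : FreeProd N →* Γ) (r : Fin l) : Multiplicative (ZMod (N r)) →* GroupCStar Γ :=
  GroupCStar.of.comp
    (π.comp (Monoid.CoprodI.of (M := fun r => Multiplicative (ZMod (N r))) (i := r)))

theorem star_gen (π : FreeProd N →* Γ) (r : Fin l) (x : Multiplicative (ZMod (N r))) :
    star (gen π r x) = gen π r x⁻¹ := by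
  simp only [gen, MonoidHom.comp_apply, GroupCStar.star_of, map_inv]

variable [∀ r, NeZero (N r)]

/-- The magic unitary of the dual of a quotient `π : ℤ_{N₁} * ⋯ * ℤ_{N_l} → Γ`: it is block
diagonal, the blocks being the matrices associated to the subgroups `ℤ_{N_r} → Γ`. -/
def magic (π : FreeProd N →* Γ) (hπ : Function.Surjective π) :
    MagicUnitary (Pts N) (GroupCStar Γ) where
  mat := Matrix.blockDiagonal' fun r => cyclicMatrix (gen π r)
  isStarProjection := by
    rintro ⟨r, i⟩ ⟨s, j⟩
    by_cases h : r = s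
    · subst h
      rw [Matrix.blockDiagonal'_apply_eq]
      exact ⟨cyclicMatrix_mul_self _ i j, cyclicMatrix_star _ (star_gen π r) i j⟩
    · rw [Matrix.blockDiagonal'_apply_ne _ _ _ h]
      exact .zero _
  row_sum := by
    rintro ⟨r, i⟩
    rw [Fintype.sum_sigma, Finset.sum_eq_single r]
    · simp only [Matrix.blockDiagonal'_apply_eq]
      rw [← sum_cyclicMatrix_zero (gen π r)]
      exact Fintype.sum_equiv (Equiv.subLeft i) _ _ fun j => cyclicMatrix_eq _ i j
    · intro s _ hs
      exact Finset.sum_eq_zero fun j _ => Matrix.blockDiagonal'_apply_ne _ _ _ hs.symm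
    · simp
  col_sum := by
    rintro ⟨r, j⟩
    rw [Fintype.sum_sigma, Finset.sum_eq_single r]
    · simp only [Matrix.blockDiagonal'_apply_eq]
      rw [← sum_cyclicMatrix_zero (gen π r)]
      exact Fintype.sum_equiv (Equiv.subRight j) _ _ fun i => cyclicMatrix_eq _ i j
    · intro s _ hs
      exact Finset.sum_eq_zero fun i _ => Matrix.blockDiagonal'_apply_ne _ _ _ hs
    · simp
  generates := by
    refine GroupCStar.generates_of.of_subset ?_
    rintro _ ⟨g, rfl⟩
    obtain ⟨x, rfl⟩ := hπ g
    induction x using Monoid.CoprodI.induction_on with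
    | one => rw [map_one, map_one]; exact one_mem _
    | of r k =>
      have := sum_cyclicMatrix (gen π r) (Multiplicative.toAdd k)
      rw [ofAdd_toAdd] at this
      change gen π r k ∈ _
      rw [← this]
      refine sum_mem fun a _ => SMulMemClass.smul_mem _ (StarAlgebra.subset_adjoin ℂ _ ?_)
      exact ⟨(⟨r, a⟩, ⟨r, 0⟩), Matrix.blockDiagonal'_apply_eq _ _ _ _⟩
    | mul x y hx hy => rw [map_mul, map_mul]; exact mul_mem hx hy

variable (N)

/-- The dual of `ℤ_{N₁} * ⋯ * ℤ_{N_l}`, as a quantum permutation group. -/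
def free : MagicUnitary (Pts N) (GroupCStar (FreeProd N)) :=
  magic (MonoidHom.id (FreeProd N)) Function.surjective_id

/-- The dual of `ℤ_{N₁} × ⋯ × ℤ_{N_l}`, as a quantum permutation group. -/
def direct : MagicUnitary (Pts N) (GroupCStar (DirectProd N)) :=
  magic (freeToDirect N) (freeToDirect_surjective N)

end GroupDual

end

noncomputable section

/-!
The left regular representation embeds `ℂ[Γ]` into `C⋆(Γ)`, so `i ∼_k j` says that a product of
minimal idempotents of the algebras `ℂ[ℤ_{N_r}]`, labelled by the differences `i_p - j_p`, is
nonzero in `ℂ[Γ]`. Two distinct idempotents of the same block are orthogonal. In the direct product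
this is the only obstruction, as characters of `Γ` show, so the product is nonzero exactly when any
two labels in the same block agree. In the free product only neighbouring factors interact, once the
trivial blocks are removed: after merging equal neighbours, the product contains a reduced word of
maximal length with nonzero coefficient. In both cases the admissible differences form a subgroup,
whose cosets are the orbitals. The free condition is weaker, and the labels `(1, 0, 0)` in blocks
`(r, s, r)` satisfy it but not the direct one.
-/

open Monoid.CoprodI
open scoped MonoidAlgebra

theorem ncard_classes_lt_of_coarser {X : Type*} [Finite X] {R S : X → X → Prop}
    (hR : Equivalence R) (hS : Equivalence S) (hRS : ∀ x y, R x y → S x y)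
    (hne : ∃ x y, S x y ∧ ¬ R x y) :
    (Set.range fun x => {y | S x y}).ncard < (Set.range fun x => {y | R x y}).ncard := by
  obtain ⟨x, y, hxy, hxy'⟩ := hne
  let saturate (C : Set X) : Set X := {y | ∃ x ∈ C, S x y}
  have hsat (x : X) : saturate {y | R x y} = {y | S x y} := Set.ext fun y =>
    ⟨fun ⟨z, hz, hzy⟩ => hS.trans (hRS _ _ hz) hzy, fun h => ⟨x, hR.refl x, h⟩⟩
  have himage : (Set.range fun x => {y | S x y}) = saturate '' Set.range fun x => {y | R x y} := by
    simp only [← Set.range_comp, Function.comp_def, hsat]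
  have hclass : {z | S x z} = {z | S y z} :=
    Set.ext fun z => ⟨hS.trans (hS.symm hxy), hS.trans hxy⟩
  rw [himage]
  refine lt_of_le_of_ne (Set.ncard_image_le (Set.toFinite _)) fun h => hxy' ?_
  have hinj := Set.injOn_of_ncard_image_eq h (Set.toFinite _)
  have hRclass : {z | R x z} = {z | R y z} := hinj ⟨x, rfl⟩ ⟨y, rfl⟩ (by rw [hsat, hsat, hclass])
  exact hRclass.ge (hR.refl y)

section LpReindex

variable {ι κ E : Type*} [NormedAddCommGroup E] {p : ℝ≥0∞}

theorem memℓp_comp_equiv (e : ι ≃ κ) {f : κ → E} (hf : Memℓp f p) :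
    Memℓp (fun i => f (e i)) p := by
  rcases p.trichotomy with rfl | rfl | hp
  · exact memℓp_zero ((memℓp_zero_iff.1 hf).preimage e.injective.injOn)
  · refine memℓp_infty ((memℓp_infty_iff.1 hf).mono ?_)
    exact Set.range_comp_subset_range e fun j => ‖f j‖
  · exact (memℓp_gen_iff hp).2 (e.summable_iff.2 ((memℓp_gen_iff hp).1 hf))

variable (E p) in
/-- Reindexing of the coordinates as an isometry of `ℓᵖ`-spaces. -/
def lpCongrLeft (𝕜 : Type*) [NormedField 𝕜] [NormedSpace 𝕜 E] [Fact (1 ≤ p)] (e : ι ≃ κ) :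
    lp (fun _ : ι => E) p ≃ₗᵢ[𝕜] lp (fun _ : κ => E) p where
  toFun f := ⟨fun j => f (e.symm j), memℓp_comp_equiv e.symm (lp.memℓp f)⟩
  invFun f := ⟨fun i => f (e i), memℓp_comp_equiv e (lp.memℓp f)⟩
  left_inv f := lp.ext (funext fun i => congrArg f (e.symm_apply_apply i))
  right_inv f := lp.ext (funext fun j => congrArg f (e.apply_symm_apply j))
  map_add' _ _ := rfl
  map_smul' _ _ := rfl
  norm_map' f := by
    rcases p.dichotomy with rfl | hp
    · rw [lp.norm_eq_ciSup, lp.norm_eq_ciSup]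
      exact e.symm.iSup_comp (g := fun i => ‖f i‖)
    · have hp : 0 < p.toReal := by positivity
      rw [lp.norm_eq_tsum_rpow hp, lp.norm_eq_tsum_rpow hp]
      exact congrArg (· ^ (1 / p.toReal)) (e.symm.tsum_eq fun i => ‖f i‖ ^ p.toReal)

end LpReindex

/-- The left regular representation, on `ℓ²(Γ)`. -/
def UnitaryRep.regular (Γ : Type u) [Group Γ] : UnitaryRep Γ where
  H := lp (fun _ : Γ => ℂ) 2
  nontrivial := by
    classical
    refine ⟨⟨lp.single 2 1 1, 0, fun h => one_ne_zero (α := ℂ) ?_⟩⟩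
    simpa using congrArg (fun f : lp (fun _ : Γ => ℂ) 2 => f 1) h
  toHom := Unitary.linearIsometryEquiv.symm.toMonoidHom.comp
    { toFun g := lpCongrLeft ℂ 2 ℂ (Equiv.mulLeft g)
      map_one' := LinearIsometryEquiv.ext fun f => lp.ext (funext fun h =>
        congrArg f (show (1 : Γ)⁻¹ * h = h by group))
      map_mul' g g' := LinearIsometryEquiv.ext fun f => lp.ext (funext fun h =>
        congrArg f (show (g * g')⁻¹ * h = g'⁻¹ * (g⁻¹ * h) by group)) }

namespace GroupCStar

variable {Γ : Type u} [Group Γ]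

/-- The extension to `C⋆(Γ)` of a unitary representation of `Γ`. -/
def eval (ρ : UnitaryRep Γ) : GroupCStar Γ →ₐ[ℂ] Op Γ ρ where
  toFun x := (incl x).1 ρ
  map_one' := rfl
  map_mul' _ _ := rfl
  map_zero' := rfl
  map_add' _ _ := rfl
  commutes' _ := rfl

/-- The canonical map from the group algebra to the group C⋆-algebra. -/
def ofGroupAlgebra : ℂ[Γ] →ₐ[ℂ] GroupCStar Γ := MonoidAlgebra.lift ℂ (GroupCStar Γ) Γ of

open Classical in
/-- The functional `x ↦ ⟨x δ₁, δ_h⟩` given by the left regular representation, which extends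
to `C⋆(Γ)` the coefficient at `h` of an element of the group algebra. -/
def regularCoeff (h : Γ) : GroupCStar Γ →ₗ[ℂ] ℂ :=
  (lp.evalCLM ℂ (fun _ : Γ => ℂ) 2 h).toLinearMap ∘ₗ
    (LinearMap.applyₗ (lp.single 2 1 1 : lp (fun _ : Γ => ℂ) 2)) ∘ₗ
    (ContinuousLinearMap.coeLM ℂ) ∘ₗ (eval (.regular Γ)).toLinearMap

theorem regularCoeff_ofGroupAlgebra (h : Γ) (a : ℂ[Γ]) :
    regularCoeff h (ofGroupAlgebra a) = a.coeff h := by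
  classical
  induction a using MonoidAlgebra.induction_linear with
  | zero => simp
  | add a b ha hb => simp [ha, hb]
  | single g c =>
    rw [ofGroupAlgebra, MonoidAlgebra.lift_single, map_smul, MonoidAlgebra.coeff_single]
    change c * (lp.single 2 1 1 : lp (fun _ : Γ => ℂ) 2) (g⁻¹ * h) = _
    simp [lp.single_apply, Pi.single_apply, Finsupp.single_apply, inv_mul_eq_one]

theorem ofGroupAlgebra_injective : Function.Injective (ofGroupAlgebra (Γ := Γ)) := by
  intro a b hab
  ext h
  rw [← regularCoeff_ofGroupAlgebra, hab, regularCoeff_ofGroupAlgebra]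

theorem prod_map_ofGroupAlgebra_ne_zero_iff (L : List ℂ[Γ]) :
    (L.map ofGroupAlgebra).prod ≠ 0 ↔ L.prod ≠ 0 := by
  rw [← map_list_prod]
  exact map_ne_zero_iff _ ofGroupAlgebra_injective

end GroupCStar

theorem lift_mapDomain {R A H K : Type*} [CommSemiring R] [Semiring A] [Algebra R A] [Monoid H]
    [Monoid K] (f : H →* K) (g : K →* A) (b : R[H]) :
    MonoidAlgebra.lift R A K g (b.mapDomain f) = MonoidAlgebra.lift R A H (g.comp f) b := by
  induction b using MonoidAlgebra.induction_linear with
  | zero => simp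
  | add b c hb hc => rw [MonoidAlgebra.mapDomain_add, map_add, map_add, hb, hc]
  | single h r => simp [MonoidAlgebra.lift_single]

theorem coeff_mapDomain_mul {R H K : Type*} [Semiring R] [Group H] [Group K] (f : H →* K)
    (b : R[H]) (a : R[K]) (h : K) :
    (b.mapDomain f * a).coeff h = b.coeff.sum fun k c => c * a.coeff ((f k)⁻¹ * h) := by
  rw [MonoidAlgebra.coeff_mul_apply_left, MonoidAlgebra.coeff_mapDomain]
  exact Finsupp.sum_mapDomain_index (by simp) (by simp [add_mul])

section CyclicIdempotent

variable {n : ℕ} [NeZero n]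

/-- The minimal idempotent of `ℂ[ℤ_n]` on which `k ∈ ℤ_n` acts by `exp(-2πiak/n)`. -/
def cyclicIdempotent (a : ZMod n) : ℂ[Multiplicative (ZMod n)] :=
  ∑ k, MonoidAlgebra.single (.ofAdd k) ((n : ℂ)⁻¹ * ZMod.stdAddChar (a * k))

theorem coeff_cyclicIdempotent (a k : ZMod n) :
    (cyclicIdempotent a).coeff (.ofAdd k) = (n : ℂ)⁻¹ * ZMod.stdAddChar (a * k) := by
  simp [cyclicIdempotent, MonoidAlgebra.coeff_sum, Finsupp.single_apply]

theorem coeff_cyclicIdempotent_ne_zero (a : ZMod n) (m : Multiplicative (ZMod n)) :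
    (cyclicIdempotent a).coeff m ≠ 0 := by
  rw [← ofAdd_toAdd m, coeff_cyclicIdempotent]
  exact mul_ne_zero (inv_ne_zero (NeZero.ne _)) (AddChar.val_isUnit _ _).ne_zero

theorem lift_cyclicIdempotent {A : Type*} [Semiring A] [Algebra ℂ A]
    (g : Multiplicative (ZMod n) →* A) (a : ZMod n) :
    MonoidAlgebra.lift ℂ A _ g (cyclicIdempotent a) =
      (n : ℂ)⁻¹ • ∑ k, (ZMod.stdAddChar (a * k) : ℂ) • g (.ofAdd k) := by
  simp [cyclicIdempotent, MonoidAlgebra.lift_single, Finset.smul_sum, mul_smul]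

theorem cyclicMatrix_eq_lift {A : Type w} [CStarAlgebra A] (g : Multiplicative (ZMod n) →* A)
    (i j : ZMod n) :
    cyclicMatrix g i j = MonoidAlgebra.lift ℂ A _ g (cyclicIdempotent (i - j)) :=
  (lift_cyclicIdempotent g (i - j)).symm

theorem lift_cyclicIdempotent_eq_one (χ : Multiplicative (ZMod n) →* ℂ) (a : ZMod n)
    (hχ : ∀ k, χ (.ofAdd k) = ZMod.stdAddChar (-(a * k))) :
    MonoidAlgebra.lift ℂ ℂ _ χ (cyclicIdempotent a) = 1 := by
  simp [lift_cyclicIdempotent, hχ, ← AddChar.map_add_eq_mul]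

theorem single_mul_cyclicIdempotent (m b : ZMod n) :
    MonoidAlgebra.single (.ofAdd m) 1 * cyclicIdempotent b =
      (ZMod.stdAddChar (-(b * m)) : ℂ) • cyclicIdempotent b := by
  ext k
  obtain ⟨k, rfl⟩ := Multiplicative.ofAdd.surjective k
  rw [MonoidAlgebra.coeff_single_mul_apply, ← ofAdd_neg, ← ofAdd_add,
    MonoidAlgebra.coeff_smul_apply, coeff_cyclicIdempotent, coeff_cyclicIdempotent, mul_add,
    mul_neg, AddChar.map_add_eq_mul, smul_eq_mul]
  ring

theorem cyclicIdempotent_mul (a b : ZMod n) :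
    cyclicIdempotent a * cyclicIdempotent b = if a = b then cyclicIdempotent a else 0 := by
  have hterm (k : ZMod n) :
      MonoidAlgebra.single (.ofAdd k) ((n : ℂ)⁻¹ * ZMod.stdAddChar (a * k)) * cyclicIdempotent b =
        ((n : ℂ)⁻¹ * ZMod.stdAddChar (k * (a - b))) • cyclicIdempotent b := by
    rw [← mul_one (_ * _ : ℂ), ← smul_eq_mul (_ * _), ← MonoidAlgebra.smul_single, smul_mul_assoc,
      single_mul_cyclicIdempotent, smul_smul, mul_assoc, ← AddChar.map_add_eq_mul]
    congr 3
    ring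
  rw [cyclicIdempotent, Finset.sum_mul, Finset.sum_congr rfl fun k _ => hterm k,
    ← Finset.sum_smul, ← Finset.mul_sum,
    AddChar.sum_mulShift _ (ZMod.isPrimitive_stdAddChar n), ← cyclicIdempotent]
  by_cases h : a = b
  · simp [h]
  · simp [h, sub_ne_zero.2 h]

theorem cyclicIdempotent_eq_one (h : n = 1) (a : ZMod n) : cyclicIdempotent a = 1 := by
  subst h
  have hsingle : cyclicIdempotent a =
      .single (.ofAdd 0) (((1 : ℕ) : ℂ)⁻¹ * ZMod.stdAddChar (a * 0)) :=
    Fintype.sum_subsingleton _ _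
  simpa [MonoidAlgebra.one_def] using hsingle

end CyclicIdempotent

section LeadingWord

variable {ι : Type*} {G : ι → Type*} [∀ i, Group (G i)]
variable {R : Type*} [Semiring R]

/-- The word `w` is a longest one in the support of the element `a` of the group algebra of a
free product. -/
def IsLeadingWord (a : R[Monoid.CoprodI G]) (w : Word G) : Prop :=
  a.coeff w.prod ≠ 0 ∧ ∀ w' : Word G, w.toList.length < w'.toList.length → a.coeff w'.prod = 0

theorem IsLeadingWord.ne_zero {a : R[Monoid.CoprodI G]} {w : Word G} (h : IsLeadingWord a w) :
    a ≠ 0 := by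
  rintro rfl
  exact h.1 rfl

theorem isLeadingWord_one [Nontrivial R] :
    IsLeadingWord (1 : R[Monoid.CoprodI G]) Word.empty := by
  classical
  refine ⟨by simp [MonoidAlgebra.one_def], fun w' h => ?_⟩
  rw [MonoidAlgebra.one_def, MonoidAlgebra.coeff_single, Finsupp.single_eq_of_ne]
  intro h1
  obtain rfl : w' = .empty := Word.equiv.symm.injective (h1.trans Word.prod_empty.symm)
  exact lt_irrefl _ h

section WordLength

variable [∀ i, DecidableEq (G i)]

theorem length_tail_le_length_rcons {i : ι} (p : Word.Pair G i) :
    p.tail.toList.length ≤ (Word.rcons p).toList.length := by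
  unfold Word.rcons
  split_ifs <;> simp [Word.cons]

theorem length_rcons_le_length_tail_add_one {i : ι} (p : Word.Pair G i) :
    (Word.rcons p).toList.length ≤ p.tail.toList.length + 1 := by
  unfold Word.rcons
  split_ifs <;> simp [Word.cons]

variable [DecidableEq ι]

theorem length_le_length_of_smul_add_one {i : ι} (m : G i) (w : Word G) :
    w.toList.length ≤ (of m • w).toList.length + 1 := by
  set p := Word.equivPair i w with hp
  calc w.toList.length = (Word.rcons p).toList.length := by
        rw [hp, ← Word.equivPair_symm, Equiv.symm_apply_apply]
    _ ≤ p.tail.toList.length + 1 := length_rcons_le_length_tail_add_one p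
    _ ≤ (of m • w).toList.length + 1 := by
        rw [Word.of_smul_def]
        exact Nat.succ_le_succ (length_tail_le_length_rcons { p with head := m * p.head })

end WordLength

/-- The leading coefficients multiply, since no other term of `b` can reach the longer word
`m w`. -/
theorem IsLeadingWord.mapDomain_mul [NoZeroDivisors R] {i : ι} {a : R[Monoid.CoprodI G]}
    {w : Word G} (ha : IsLeadingWord a w) {b : R[G i]} {m : G i} (hb : b.coeff m ≠ 0)
    (hw : w.fstIdx ≠ some i) (hm : m ≠ 1) :
    IsLeadingWord (b.mapDomain (of (i := i)) * a) (.cons m w hw hm) := by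
  classical
  constructor
  · have hvanish : ∀ k ≠ m, a.coeff ((of k)⁻¹ * (Word.cons m w hw hm).prod) = 0 := by
      intro k hk
      have hkm : k⁻¹ * m ≠ 1 := fun h => hk (inv_mul_eq_one.1 h)
      rw [Word.prod_cons, ← map_inv, ← mul_assoc, ← map_mul, ← Word.prod_cons _ _ _ hkm hw]
      exact ha.2 _ (Nat.lt_succ_self _)
    rw [coeff_mapDomain_mul, Finsupp.sum_eq_single m]
    · rw [Word.prod_cons, inv_mul_cancel_left]
      exact mul_ne_zero hb ha.1
    · intro k _ hk
      rw [hvanish k hk, mul_zero]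
    · simp
  · intro w' hw'
    rw [coeff_mapDomain_mul]
    refine Finset.sum_eq_zero fun k _ => ?_
    have hk : a.coeff ((of k)⁻¹ * w'.prod) = 0 := by
      rw [← map_inv, ← Word.prod_smul]
      exact ha.2 _ (Nat.lt_of_succ_lt_succ
        (hw'.trans_le (length_le_length_of_smul_add_one _ w')))
    exact mul_eq_zero_of_right _ hk

end LeadingWord

namespace GroupDual

section Compat

variable {ι : Type*} {M : ι → Type*}

/-- Two labels of minimal idempotents are compatible when they are not distinct labels in the same
block. -/
def Compat (x y : Σ i, M i) : Prop := x.1 = y.1 → x = y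

theorem Compat.symm {x y : Σ i, M i} (h : Compat x y) : Compat y x := fun e => (h e.symm).symm

theorem exists_section_of_pairwise_compat [∀ i, Inhabited (M i)] {L : List (Σ i, M i)}
    (hL : L.Pairwise Compat) : ∃ c : ∀ i, M i, ∀ x ∈ L, x.2 = c x.1 := by
  have : Std.Symm (Compat (M := M)) := ⟨fun _ _ => Compat.symm⟩
  have hL := hL.forall_of_forall fun _ _ _ => rfl
  have hex (i : ι) : ∃ a : M i, ∀ x ∈ L, x.1 = i → x = ⟨i, a⟩ := by
    by_cases hi : ∃ y ∈ L, y.1 = i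
    · obtain ⟨⟨_, a⟩, hy, rfl⟩ := hi
      exact ⟨a, fun x hx h => hL hx hy h⟩
    · exact ⟨default, fun x hx h => (hi ⟨x, hx, h⟩).elim⟩
  choose c hc using hex
  exact ⟨c, fun x hx => eq_of_heq (Sigma.mk.inj (hc x.1 x hx rfl)).2⟩

variable [∀ i, AddGroup (M i)]

theorem Compat.add {i j : ι} {a a' : M i} {b b' : M j}
    (h : Compat ⟨i, a⟩ ⟨j, b⟩) (h' : Compat ⟨i, a'⟩ ⟨j, b'⟩) :
    Compat ⟨i, a + a'⟩ ⟨j, b + b'⟩ := by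
  rintro rfl
  obtain rfl : a = b := eq_of_heq (Sigma.mk.inj (h rfl)).2
  obtain rfl : a' = b' := eq_of_heq (Sigma.mk.inj (h' rfl)).2
  rfl

theorem Compat.neg {i j : ι} {a : M i} {b : M j} (h : Compat ⟨i, a⟩ ⟨j, b⟩) :
    Compat ⟨i, -a⟩ ⟨j, -b⟩ := by
  rintro rfl
  obtain rfl : a = b := eq_of_heq (Sigma.mk.inj (h rfl)).2
  rfl

theorem Compat.zero (i j : ι) : Compat (M := M) ⟨i, 0⟩ ⟨j, 0⟩ := by
  rintro rfl
  rfl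

/-- The group of the families of labels, with prescribed blocks `b`, whose terms are compatible
at the pairs of positions linked by `F`. -/
def linkedSubgroup {P : Type*} (b : P → ι) (F : P → P → Prop) :
    AddSubgroup (∀ p, M (b p)) where
  carrier := {c | ∀ p q, F p q → Compat ⟨b p, c p⟩ ⟨b q, c q⟩}
  zero_mem' _ _ _ := .zero _ _
  add_mem' hc hd p q hpq := (hc p q hpq).add (hd p q hpq)
  neg_mem' hc p q hpq := (hc p q hpq).neg

theorem mem_linkedSubgroup {P : Type*} {b : P → ι} {F : P → P → Prop} {c : ∀ p, M (b p)} :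
    c ∈ linkedSubgroup b F ↔ ∀ p q, F p q → Compat (M := M) ⟨b p, c p⟩ ⟨b q, c q⟩ :=
  Iff.rfl

end Compat

variable {l : ℕ} {N : Fin l → ℕ} [∀ r, NeZero (N r)]

section BlockIdempotent

variable {Γ : Type u} [Group Γ] (π : FreeProd N →* Γ)

/-- The image in `ℂ[Γ]` of the minimal idempotent of `ℂ[ℤ_{N_r}]` labelled by `a`, where
`x = (r, a)`. -/
def blockIdempotent (x : Pts N) : ℂ[Γ] :=
  (cyclicIdempotent x.2).mapDomain (π.comp (of (M := fun r => Multiplicative (ZMod (N r)))))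

theorem blockIdempotent_mul_self (x : Pts N) :
    blockIdempotent π x * blockIdempotent π x = blockIdempotent π x := by
  rw [blockIdempotent, ← MonoidAlgebra.mapDomain_mul, cyclicIdempotent_mul, if_pos rfl]

theorem blockIdempotent_mul_of_not_compat {x y : Pts N} (h : ¬ Compat x y) :
    blockIdempotent π x * blockIdempotent π y = 0 := by
  obtain ⟨r, a⟩ := x
  obtain ⟨s, b⟩ := y
  obtain ⟨rfl : r = s, hab⟩ := Classical.not_imp.1 h
  have hab : a ≠ b := fun h => hab (congrArg (Sigma.mk r) h)
  rw [blockIdempotent, blockIdempotent, ← MonoidAlgebra.mapDomain_mul, cyclicIdempotent_mul,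
    if_neg hab, MonoidAlgebra.mapDomain_zero]

theorem blockIdempotent_eq_one {x : Pts N} (h : N x.1 = 1) : blockIdempotent π x = 1 := by
  rw [blockIdempotent, cyclicIdempotent_eq_one h, MonoidAlgebra.mapDomain_one]

theorem prod_filter_blockIdempotent (L : List (Pts N)) :
    ((L.filter fun x => N x.1 ≠ 1).map (blockIdempotent π)).prod =
      (L.map (blockIdempotent π)).prod := by
  induction L with
  | nil => rfl
  | cons x L ih =>
    by_cases hx : N x.1 = 1
    · simpa [hx, blockIdempotent_eq_one π hx] using ih
    · simpa [hx] using congrArg (blockIdempotent π x * ·) ih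

theorem isChain_compat_of_prod_ne_zero {L : List (Pts N)}
    (h : (L.map (blockIdempotent π)).prod ≠ 0) : L.IsChain Compat := by
  refine List.isChain_iff_forall_rel_of_append_cons_cons.2 fun x y A B hL => ?_
  contrapose! h
  rw [hL, List.map_append, List.map_cons, List.map_cons, List.prod_append, List.prod_cons,
    List.prod_cons, ← mul_assoc (blockIdempotent π x), blockIdempotent_mul_of_not_compat π h,
    zero_mul, mul_zero]

end BlockIdempotent

section Free

theorem exists_isLeadingWord_prod (L : List (Pts N)) (hL : ∀ x ∈ L, N x.1 ≠ 1)
    (hc : L.IsChain Compat) :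
    ∃ w, w.fstIdx = L.head?.map Sigma.fst ∧
      IsLeadingWord (L.map (blockIdempotent (.id (FreeProd N)))).prod w := by
  induction L with
  | nil => exact ⟨.empty, rfl, isLeadingWord_one⟩
  | cons x L ih =>
    obtain ⟨w, hfst, hw⟩ := ih (fun y hy => hL y (List.mem_cons_of_mem _ hy)) hc.tail
    rw [List.map_cons, List.prod_cons]
    by_cases hx : w.fstIdx = some x.1
    · refine ⟨w, hx, ?_⟩
      cases L with
      | nil => cases hfst.symm.trans hx
      | cons y L =>
        have hyx : y.1 = x.1 := Option.some.inj (hfst.symm.trans hx)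
        obtain rfl : x = y := (List.isChain_cons_cons.1 hc).1 hyx.symm
        rwa [List.map_cons, List.prod_cons, ← mul_assoc, blockIdempotent_mul_self,
          ← List.prod_cons, ← List.map_cons]
    · have : Fact (1 < N x.1) :=
        ⟨lt_of_le_of_ne NeZero.one_le (hL x List.mem_cons_self).symm⟩
      have hone : Multiplicative.ofAdd (1 : ZMod (N x.1)) ≠ 1 := one_ne_zero (α := ZMod (N x.1))
      exact ⟨.cons _ w hx hone, Word.fstIdx_cons _ _ _ _,
        hw.mapDomain_mul (coeff_cyclicIdempotent_ne_zero x.2 _) hx hone⟩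

theorem prod_free_ne_zero_iff (L : List (Pts N)) :
    (L.map (blockIdempotent (.id (FreeProd N)))).prod ≠ 0 ↔
      (L.filter fun x => N x.1 ≠ 1).IsChain Compat := by
  rw [← prod_filter_blockIdempotent]
  refine ⟨isChain_compat_of_prod_ne_zero _, fun h => ?_⟩
  obtain ⟨w, -, hw⟩ := exists_isLeadingWord_prod _
    (fun x hx => by simpa using (List.mem_filter.1 hx).2) h
  exact hw.ne_zero

end Free

section Direct

theorem pairwise_compat_of_prod_ne_zero {L : List (Pts N)}
    (h : (L.map (blockIdempotent (freeToDirect N))).prod ≠ 0) : L.Pairwise Compat := by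
  induction L with
  | nil => exact .nil
  | cons x L ih =>
    rw [List.map_cons, List.prod_cons] at h
    refine .cons (fun y hy => ?_) (ih (right_ne_zero_of_mul h))
    contrapose! h
    obtain ⟨z, hz⟩ := List.dvd_prod (List.mem_map_of_mem (f := blockIdempotent (freeToDirect N)) hy)
    rw [hz, ← mul_assoc, blockIdempotent_mul_of_not_compat _ h, zero_mul]

theorem exists_character_eq_one (c : ∀ r, ZMod (N r)) :
    ∃ χ : DirectProd N →* ℂ, ∀ r,
      MonoidAlgebra.lift ℂ ℂ _ χ (blockIdempotent (freeToDirect N) ⟨r, c r⟩) = 1 := by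
  refine ⟨MonoidHom.noncommPiCoprod
    (fun r => (AddChar.mulShift ZMod.stdAddChar (-c r)).toMonoidHom)
    fun _ _ _ _ _ => Commute.all _ _, fun r => ?_⟩
  rw [blockIdempotent, lift_mapDomain]
  refine lift_cyclicIdempotent_eq_one _ (c r) fun k => ?_
  have hgen : freeToDirect N (of (.ofAdd k)) = Pi.mulSingle r (.ofAdd k) :=
    Monoid.CoprodI.lift_of _ _
  rw [MonoidHom.comp_apply, MonoidHom.comp_apply, hgen]
  refine (MonoidHom.noncommPiCoprod_mulSingle _ _ _).trans ?_
  rw [AddChar.toMonoidHom_apply, AddChar.mulShift_apply, neg_mul]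
  rfl

theorem prod_direct_ne_zero_iff (L : List (Pts N)) :
    (L.map (blockIdempotent (freeToDirect N))).prod ≠ 0 ↔ L.Pairwise Compat := by
  refine ⟨pairwise_compat_of_prod_ne_zero, fun h h0 => ?_⟩
  obtain ⟨c, hc⟩ := exists_section_of_pairwise_compat h
  obtain ⟨χ, hχ⟩ := exists_character_eq_one c
  have hprod : MonoidAlgebra.lift ℂ ℂ _ χ (L.map (blockIdempotent (freeToDirect N))).prod = 1 := by
    rw [map_list_prod, List.map_map]
    refine List.prod_eq_one ?_
    simp only [List.mem_map, Function.comp_apply]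
    rintro _ ⟨⟨r, a⟩, hx, rfl⟩
    obtain rfl : a = c r := hc _ hx
    exact hχ r
  rw [h0, map_zero] at hprod
  exact zero_ne_one hprod

end Direct

section Rel

variable {Γ : Type u} [Group Γ] (π : FreeProd N →* Γ) (hπ : Function.Surjective π) {k : ℕ}

theorem magic_mat_same_block (r : Fin l) (a a' : ZMod (N r)) :
    (magic π hπ).mat ⟨r, a⟩ ⟨r, a'⟩ =
      GroupCStar.ofGroupAlgebra (blockIdempotent π ⟨r, a - a'⟩) := by
  rw [blockIdempotent, GroupCStar.ofGroupAlgebra, lift_mapDomain]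
  exact (Matrix.blockDiagonal'_apply_eq (fun r => cyclicMatrix (gen π r)) r a a').trans
    (cyclicMatrix_eq_lift (gen π r) a a')

theorem magic_rel_mk_iff {b : Fin k → Fin l} (a a' : ∀ p, ZMod (N (b p))) :
    (magic π hπ).Rel k (fun p => ⟨b p, a p⟩) (fun p => ⟨b p, a' p⟩) ↔
      (((List.finRange k).map fun p => ⟨b p, a p - a' p⟩).map (blockIdempotent π)).prod ≠ 0 := by
  rw [← GroupCStar.prod_map_ofGroupAlgebra_ne_zero_iff, MagicUnitary.Rel, List.ofFn_eq_map]
  simp only [magic_mat_same_block, List.map_map, Function.comp_def]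

theorem fst_eq_of_magic_rel {i j : Fin k → Pts N} (h : (magic π hπ).Rel k i j) (p : Fin k) :
    (j p).1 = (i p).1 := by
  contrapose! h
  refine not_not.2 (List.prod_eq_zero (List.mem_ofFn.2 ⟨p, ?_⟩))
  exact Matrix.blockDiagonal'_apply_ne (fun r => cyclicMatrix (gen π r)) _ _ h.symm

theorem exists_eq_mk_of_magic_rel {b : Fin k → Fin l} {a : ∀ p, ZMod (N (b p))}
    {j : Fin k → Pts N} (h : (magic π hπ).Rel k (fun p => ⟨b p, a p⟩) j) :
    ∃ a' : ∀ p, ZMod (N (b p)), j = fun p => ⟨b p, a' p⟩ := by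
  have hfst := fst_eq_of_magic_rel π hπ h
  obtain rfl : (fun p => (j p).1) = b := funext hfst
  exact ⟨fun p => (j p).2, rfl⟩

theorem magic_rel_equivalence
    (hK : ∀ b : Fin k → Fin l, ∃ K : AddSubgroup (∀ p, ZMod (N (b p))), ∀ c,
      (((List.finRange k).map fun p => ⟨b p, c p⟩).map (blockIdempotent π)).prod ≠ 0 ↔ c ∈ K) :
    Equivalence ((magic π hπ).Rel k) := by
  choose K hK using hK
  have rel_iff {b : Fin k → Fin l} (a a' : ∀ p, ZMod (N (b p))) :
      (magic π hπ).Rel k (fun p => ⟨b p, a p⟩) (fun p => ⟨b p, a' p⟩) ↔ a - a' ∈ K b :=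
    (magic_rel_mk_iff π hπ a a').trans (hK b (a - a'))
  constructor
  · intro i
    exact (rel_iff (fun p => (i p).2) _).2 (by simp [zero_mem])
  · intro i j hij
    obtain ⟨a', rfl⟩ := exists_eq_mk_of_magic_rel π hπ (a := fun p => (i p).2) hij
    rw [rel_iff, ← neg_sub]
    exact neg_mem ((rel_iff _ _).1 hij)
  · intro i j m hij hjm
    obtain ⟨a', rfl⟩ := exists_eq_mk_of_magic_rel π hπ (a := fun p => (i p).2) hij
    obtain ⟨a'', rfl⟩ := exists_eq_mk_of_magic_rel π hπ hjm
    refine (rel_iff (fun p => (i p).2) a'').2 ?_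
    rw [← sub_add_sub_cancel _ a' a'']
    exact add_mem ((rel_iff _ _).1 hij) ((rel_iff _ _).1 hjm)

end Rel

variable (N) in
theorem direct_rel_equivalence (k : ℕ) : Equivalence ((direct N).Rel k) := by
  refine magic_rel_equivalence _ _ fun b =>
    ⟨linkedSubgroup (M := fun r => ZMod (N r)) b (· < ·), fun c => ?_⟩
  rw [prod_direct_ne_zero_iff, ← List.ofFn_eq_map, List.pairwise_ofFn, mem_linkedSubgroup]

variable (N) in
theorem free_rel_equivalence (k : ℕ) : Equivalence ((free N).Rel k) := by
  refine magic_rel_equivalence _ _ fun b =>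
    ⟨linkedSubgroup (M := fun r => ZMod (N r)) b fun p q =>
      ∃ A B, (List.finRange k).filter (fun p => N (b p) ≠ 1) = A ++ p :: q :: B, fun c => ?_⟩
  rw [prod_free_ne_zero_iff, List.filter_map, List.isChain_map,
    List.isChain_iff_forall_rel_of_append_cons_cons]
  exact ⟨fun h p q ⟨A, B, hAB⟩ => h hAB, fun h p q A B hAB => h p q ⟨A, B, hAB⟩⟩

theorem free_rel_of_direct_rel {k : ℕ} {i j : Fin k → Pts N} (h : (direct N).Rel k i j) :
    (free N).Rel k i j := by
  obtain ⟨a', rfl⟩ := exists_eq_mk_of_magic_rel _ _ (a := fun p => (i p).2) h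
  have hpair := (prod_direct_ne_zero_iff _).1 ((magic_rel_mk_iff _ _ _ a').1 h)
  exact (magic_rel_mk_iff _ _ _ a').2 ((prod_free_ne_zero_iff _).2 (hpair.filter _).isChain)

theorem exists_free_rel_not_direct_rel {r s : Fin l} (hrs : r ≠ s) (hr : 2 ≤ N r)
    (hs : 2 ≤ N s) :
    ∃ i j : Fin 3 → Pts N, (free N).Rel 3 i j ∧ ¬ (direct N).Rel 3 i j := by
  have : Fact (1 < N r) := ⟨hr⟩
  have rel_iff {Γ : Type} [Group Γ] (π : FreeProd N →* Γ) (hπ : Function.Surjective π) :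
      (magic π hπ).Rel 3 ![⟨r, 1⟩, ⟨s, 0⟩, ⟨r, 0⟩] ![⟨r, 0⟩, ⟨s, 0⟩, ⟨r, 0⟩] ↔
        (([⟨r, 1⟩, ⟨s, 0⟩, ⟨r, 0⟩] : List (Pts N)).map (blockIdempotent π)).prod ≠ 0 := by
    rw [← GroupCStar.prod_map_ofGroupAlgebra_ne_zero_iff]
    simp [MagicUnitary.Rel, magic_mat_same_block]
  refine ⟨_, _, (rel_iff _ _).2 ((prod_free_ne_zero_iff _).2 ?_), fun h => ?_⟩
  · have hr1 : N r ≠ 1 := by lia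
    have hs1 : N s ≠ 1 := by lia
    simp [hr1, hs1, Compat, hrs, hrs.symm]
  · have hpair := (prod_direct_ne_zero_iff _).1 ((rel_iff _ _).1 h)
    simp [Compat] at hpair

end GroupDual

end

theorem proposition6p6 (l : ℕ) (N : Fin l → ℕ) [∀ r, NeZero (N r)] :
    (∀ k : ℕ, Equivalence ((GroupDual.direct N).Rel k) ∧
      Equivalence ((GroupDual.free N).Rel k)) ∧
    ((∃ r s : Fin l, r ≠ s ∧ 2 ≤ N r ∧ 2 ≤ N s) →
      (GroupDual.direct N).orbitals 3 ≠ (GroupDual.free N).orbitals 3 ∧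
      ((GroupDual.free N).orbitals 3).ncard < ((GroupDual.direct N).orbitals 3).ncard) := by
  have hdirect := GroupDual.direct_rel_equivalence N
  have hfree := GroupDual.free_rel_equivalence N
  refine ⟨fun k => ⟨hdirect k, hfree k⟩, ?_⟩
  rintro ⟨r, s, hrs, hr, hs⟩
  have hlt : ((GroupDual.free N).orbitals 3).ncard < ((GroupDual.direct N).orbitals 3).ncard :=
    ncard_classes_lt_of_coarser (hdirect 3) (hfree 3)
      (fun _ _ => GroupDual.free_rel_of_direct_rel)
      (GroupDual.exists_free_rel_not_direct_rel hrs hr hs)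
  exact ⟨fun h => hlt.ne (by rw [h]), hlt⟩
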